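/- An mm-space is a triple $(X,d_X,m_X)$, where $(X,d_X)$ is a complete separable metric space and $m_X$ is a Borel probability measure on $X$. For a measure space $(\Omega,\mu)$ and measurable functions $f,g:\Omega\to\mathbb{R}$ the Ky Fan metric is $$d_{\mathrm{KF}}^{\mu}(f,g)=\inf\{\varepsilon\ge 0 : \mu(\{x\in\Omega : |f(x)-g(x)|>\varepsilon\})\le\varepsilon\},$$ and $d_{\mathrm H}^{d_{\mathrm{KF}}^{\mu}}$ denotes the Hausdorff distance between sets of such functions with respect to $d_{\mathrm{KF}}^{\mu}$. Let $\mathrm{Lip}_1(X)$ be the set of $1$-Lipschitz functions $X\to\mathbb{R}$, and for a map $p:\Omega\to X$ put $p^*\mathrm{Lip}_1(X)=\{f\circ p : f\in \mathrm{Lip}_1(X)\}$. A parameter of $X$ is a Borel measurable map $\varphi:[0,1)\to X$ with $\varphi_*\mathcal{L}^1=m_X$, where $\mathcal{L}^1$ is the Lebesgue measure on $[0,1)$. The observable distance between mm-spaces $X$ and $Y$ is $$d_{\mathrm{conc}}(X,Y)=\inf_{\varphi,\psi} d_{\mathrm H}^{d_{\mathrm{KF}}^{\mathcal{L}^1}}\bigl(\varphi^*\mathrm{Lip}_1(X),\psi^*\mathrm{Lip}_1(Y)\bigr),$$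 where $\varphi$ and $\psi$ run over all parameters of $X$ and $Y$, respectively. Let $\Pi(m_X,m_Y)$ be the set of transport plans, that is, of Borel probability measures $\pi$ on $X\times Y$ with $(\mathrm{pr}_1)_*\pi=m_X$ and $(\mathrm{pr}_2)_*\pi=m_Y$, where $\mathrm{pr}_1,\mathrm{pr}_2$ are the projections, and for $\pi\in\Pi(m_X,m_Y)$ put $$d_{\mathrm{conc}}^{\pi}(X,Y)=d_{\mathrm H}^{d_{\mathrm{KF}}^{\pi}}\bigl(\mathrm{pr}_1^*\mathrm{Lip}_1(X),\mathrm{pr}_2^*\mathrm{Lip}_1(Y)\bigr).$$ **Theorem.** For any two mm-spaces $X$ and $Y$, $$d_{\mathrm{conc}}(X,Y)=\min_{\pi\in\Pi(m_X,m_Y)} d_{\mathrm{conc}}^{\pi}(X,Y);$$ in particular the minimum on the right is attained by some transport plan. -/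

import Mathlib

open MeasureTheory Set TopologicalSpace
open scoped ENNReal

/-- The Ky Fan distance `inf {ε ≥ 0 | μ {x | |f x - g x| > ε} ≤ ε}` of two real functions, with
values in `[0, ∞]` (it is at most `1` when `μ` is a probability measure). -/
noncomputable def kyFanDist {Ω : Type*} [MeasurableSpace Ω] (μ : Measure Ω) (f g : Ω → ℝ) : ℝ≥0∞ :=
  sInf {ε : ℝ≥0∞ | μ {x | ε < ENNReal.ofReal |f x - g x|} ≤ ε}

theorem kyFanDist_self {Ω : Type*} [MeasurableSpace Ω] (μ : Measure Ω) (f : Ω → ℝ) :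
    kyFanDist μ f f = 0 :=
  le_antisymm (sInf_le (by simp)) zero_le

theorem kyFanDist_comm {Ω : Type*} [MeasurableSpace Ω] (μ : Measure Ω) (f g : Ω → ℝ) :
    kyFanDist μ f g = kyFanDist μ g f := by
  simp only [kyFanDist, abs_sub_comm]

theorem kyFanDist_triangle {Ω : Type*} [MeasurableSpace Ω] (μ : Measure Ω) (f g h : Ω → ℝ) :
    kyFanDist μ f h ≤ kyFanDist μ f g + kyFanDist μ g h := by
  unfold kyFanDist
  rw [ENNReal.sInf_add]
  refine le_iInf₂ fun a ha => ?_
  rw [add_comm, ENNReal.sInf_add]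
  refine le_iInf₂ fun b hb => sInf_le ?_
  have hsub : {x | b + a < ENNReal.ofReal |f x - h x|} ⊆
      {x | b < ENNReal.ofReal |g x - h x|} ∪ {x | a < ENNReal.ofReal |f x - g x|} := by
    intro x hx
    by_contra hcon
    simp only [mem_union, mem_ofPred_eq, not_or, not_lt] at hcon hx
    refine absurd hx (not_lt.2 ?_)
    calc ENNReal.ofReal |f x - h x| ≤ ENNReal.ofReal (|g x - h x| + |f x - g x|) :=
          ENNReal.ofReal_le_ofReal (by rw [add_comm]; exact abs_sub_le _ _ _)
      _ ≤ ENNReal.ofReal |g x - h x| + ENNReal.ofReal |f x - g x| := ENNReal.ofReal_add_le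
      _ ≤ b + a := add_le_add hcon.1 hcon.2
  exact (measure_mono hsub).trans ((measure_union_le _ _).trans (add_le_add hb ha))

/-- The Ky Fan distance as a pseudo-metric on the real functions on `Ω`. -/
@[reducible] noncomputable def kyFanPseudoEMetric {Ω : Type*} [MeasurableSpace Ω] (μ : Measure Ω) :
    PseudoEMetricSpace (Ω → ℝ) where
  edist := kyFanDist μ
  edist_self := kyFanDist_self μ
  edist_comm := kyFanDist_comm μ
  edist_triangle := kyFanDist_triangle μ

/-- The Hausdorff distance of two sets of real functions, with respect to the Ky Fan distance. -/
noncomputable def kyFanHausdorffDist {Ω : Type*} [MeasurableSpace Ω] (μ : Measure Ω)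
    (A B : Set (Ω → ℝ)) : ℝ≥0∞ :=
  @Metric.hausdorffEDist (Ω → ℝ) (kyFanPseudoEMetric μ) A B

/-- The pull-back `p^* Lip₁(X) = {f ∘ p | f : X → ℝ is 1-Lipschitz}`. -/
def pullbackLip₁ {Ω X : Type*} [MetricSpace X] (p : Ω → X) : Set (Ω → ℝ) :=
  {F | ∃ f : X → ℝ, LipschitzWith 1 f ∧ F = f ∘ p}

/-- Lebesgue measure on `[0, 1)`. -/
noncomputable def lebesgueIco : Measure (Ico (0 : ℝ) 1) :=
  Measure.comap Subtype.val (volume : Measure ℝ)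

/-- A parameter of `(X, m)`: a Borel map `φ : [0, 1) → X` that pushes Lebesgue measure
to `m`. -/
def IsParameter {X : Type*} [MeasurableSpace X] (m : Measure X) (φ : Ico (0 : ℝ) 1 → X) : Prop :=
  Measurable φ ∧ Measure.map φ lebesgueIco = m

/-- The observable distance of two metric measure spaces: the infimum is over all pairs of
parameters. -/
noncomputable def observableDist {X Y : Type*} [MetricSpace X] [MeasurableSpace X]
    [MetricSpace Y] [MeasurableSpace Y] (mX : Measure X) (mY : Measure Y) : ℝ≥0∞ :=
  ⨅ (φ : Ico (0 : ℝ) 1 → X) (_ : IsParameter mX φ) (ψ : Ico (0 : ℝ) 1 → Y)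
    (_ : IsParameter mY ψ),
    kyFanHausdorffDist lebesgueIco (pullbackLip₁ φ) (pullbackLip₁ ψ)

/-- The set `Π(mX, mY)` of transport plans. -/
def transportPlans {X Y : Type*} [MeasurableSpace X] [MeasurableSpace Y]
    (mX : Measure X) (mY : Measure Y) : Set (Measure (X × Y)) :=
  {π | IsProbabilityMeasure π ∧ Measure.map Prod.fst π = mX ∧ Measure.map Prod.snd π = mY}

/-- The observable distance with respect to a plan `π`. -/
noncomputable def planObservableDist {X Y : Type*} [MetricSpace X] [MeasurableSpace X]
    [MetricSpace Y] [MeasurableSpace Y] (π : Measure (X × Y)) : ℝ≥0∞ :=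
  kyFanHausdorffDist π (pullbackLip₁ (Prod.fst : X × Y → X)) (pullbackLip₁ (Prod.snd : X × Y → Y))

/-! The Ky Fan distance between `f ∘ φ` and `g ∘ ψ` depends only on the joint law of `(φ, ψ)`. Two
parameters thus give a plan with the same Hausdorff distance (`planObservableDist_map`). Conversely,
a plan is a Borel probability measure on a Polish space, so it has a parameter, whose two components
are parameters of `X` and `Y`. Hence the observable distance is the infimum over plans.

The infimum is attained because the plans form a weakly compact set (Prokhorov) on which
`planObservableDist` is lower semicontinuous. For the latter, near-optimal 1-Lipschitz partners of a
fixed function converge pointwise along an ultrafilter, hence uniformly on compact sets; tightness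
and the portmanteau inequality for open sets carry the Ky Fan bound to the limit. -/

open Filter
open scoped Topology unitInterval

/-! ### Ky Fan and Hausdorff distances under push-forward -/

section Hausdorff

variable {Ω X Y : Type*} [MeasurableSpace Ω] [MetricSpace X] [MetricSpace Y]

theorem kyFanDist_le_one (μ : Measure Ω) [IsProbabilityMeasure μ] (f g : Ω → ℝ) :
    kyFanDist μ f g ≤ 1 :=
  sInf_le prob_le_one

/-- The admissible `ε` in the Ky Fan infimum form an upward closed set. -/
theorem measure_lt_le_of_kyFanDist_lt {μ : Measure Ω} {f g : Ω → ℝ} {r : ℝ≥0∞}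
    (h : kyFanDist μ f g < r) : μ {x | r < ENNReal.ofReal |f x - g x|} ≤ r := by
  obtain ⟨ε, hε, hεr⟩ := sInf_lt_iff.1 h
  exact (measure_mono fun x hx => hεr.trans hx).trans (hε.trans hεr.le)

theorem kyFanDist_map {Z : Type*} [MeasurableSpace Z] {μ : Measure Ω} {p : Ω → Z}
    (hp : Measurable p) {f g : Z → ℝ} (hf : Measurable f) (hg : Measurable g) :
    kyFanDist (μ.map p) f g = kyFanDist μ (f ∘ p) (g ∘ p) := by
  have h (ε : ℝ≥0∞) : MeasurableSet {x | ε < ENNReal.ofReal |f x - g x|} :=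
    measurableSet_lt measurable_const (hf.sub hg).abs.ennreal_ofReal
  simp only [kyFanDist, Measure.map_apply hp (h _)]
  rfl

theorem kyFanHausdorffDist_comm (μ : Measure Ω) (A B : Set (Ω → ℝ)) :
    kyFanHausdorffDist μ A B = kyFanHausdorffDist μ B A :=
  @Metric.hausdorffEDist_comm _ (kyFanPseudoEMetric μ) _ _

theorem kyFanHausdorffDist_pullback_le {μ : Measure Ω} {p : Ω → X} {q : Ω → Y} {r : ℝ≥0∞}
    (h₁ : ∀ f : X → ℝ, LipschitzWith 1 f →
      ∃ g : Y → ℝ, LipschitzWith 1 g ∧ kyFanDist μ (f ∘ p) (g ∘ q) ≤ r)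
    (h₂ : ∀ g : Y → ℝ, LipschitzWith 1 g →
      ∃ f : X → ℝ, LipschitzWith 1 f ∧ kyFanDist μ (g ∘ q) (f ∘ p) ≤ r) :
    kyFanHausdorffDist μ (pullbackLip₁ p) (pullbackLip₁ q) ≤ r := by
  let _ := kyFanPseudoEMetric μ
  refine Metric.hausdorffEDist_le_of_mem_edist ?_ ?_
  · rintro _ ⟨f, hf, rfl⟩
    obtain ⟨g, hg, h⟩ := h₁ f hf
    exact ⟨_, ⟨g, hg, rfl⟩, h⟩
  · rintro _ ⟨g, hg, rfl⟩
    obtain ⟨f, hf, h⟩ := h₂ g hg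
    exact ⟨_, ⟨f, hf, rfl⟩, h⟩

theorem exists_kyFanDist_lt_of_kyFanHausdorffDist_lt {μ : Measure Ω} {p : Ω → X} {q : Ω → Y}
    {r : ℝ≥0∞} (h : kyFanHausdorffDist μ (pullbackLip₁ p) (pullbackLip₁ q) < r)
    {f : X → ℝ} (hf : LipschitzWith 1 f) :
    ∃ g : Y → ℝ, LipschitzWith 1 g ∧ kyFanDist μ (f ∘ p) (g ∘ q) < r := by
  let _ := kyFanPseudoEMetric μ
  obtain ⟨_, ⟨g, hg, rfl⟩, h⟩ :=
    Metric.exists_edist_lt_of_hausdorffEDist_lt (show f ∘ p ∈ pullbackLip₁ p from ⟨f, hf, rfl⟩) h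
  exact ⟨g, hg, h⟩

theorem kyFanHausdorffDist_pullback_mono {Ω' : Type*} [MeasurableSpace Ω'] {μ : Measure Ω}
    {ν : Measure Ω'} {p : Ω → X} {q : Ω → Y} {p' : Ω' → X} {q' : Ω' → Y}
    (h : ∀ f g, LipschitzWith 1 f → LipschitzWith 1 g →
      kyFanDist μ (f ∘ p) (g ∘ q) ≤ kyFanDist ν (f ∘ p') (g ∘ q')) :
    kyFanHausdorffDist μ (pullbackLip₁ p) (pullbackLip₁ q) ≤
      kyFanHausdorffDist ν (pullbackLip₁ p') (pullbackLip₁ q') := by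
  refine le_of_forall_gt_imp_ge_of_dense fun r hr => kyFanHausdorffDist_pullback_le ?_ ?_
  · intro f hf
    obtain ⟨g, hg, hfg⟩ := exists_kyFanDist_lt_of_kyFanHausdorffDist_lt hr hf
    exact ⟨g, hg, (h f g hf hg).trans hfg.le⟩
  · intro g hg
    rw [kyFanHausdorffDist_comm] at hr
    obtain ⟨f, hf, hfg⟩ := exists_kyFanDist_lt_of_kyFanHausdorffDist_lt hr hg
    rw [kyFanDist_comm] at hfg
    refine ⟨f, hf, ?_⟩
    rw [kyFanDist_comm]
    exact (h f g hf hg).trans hfg.le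

theorem planObservableDist_map [MeasurableSpace X] [BorelSpace X] [MeasurableSpace Y]
    [BorelSpace Y] {μ : Measure Ω} {φ : Ω → X} {ψ : Ω → Y} (hφ : Measurable φ)
    (hψ : Measurable ψ) :
    planObservableDist (μ.map fun ω => (φ ω, ψ ω)) =
      kyFanHausdorffDist μ (pullbackLip₁ φ) (pullbackLip₁ ψ) := by
  have h (f : X → ℝ) (g : Y → ℝ) (hf : LipschitzWith 1 f) (hg : LipschitzWith 1 g) :
      kyFanDist (μ.map fun ω => (φ ω, ψ ω)) (f ∘ Prod.fst) (g ∘ Prod.snd) =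
        kyFanDist μ (f ∘ φ) (g ∘ ψ) :=
    kyFanDist_map (hφ.prodMk hψ) (hf.continuous.measurable.comp measurable_fst)
      (hg.continuous.measurable.comp measurable_snd)
  exact le_antisymm (kyFanHausdorffDist_pullback_mono fun f g hf hg => (h f g hf hg).le)
    (kyFanHausdorffDist_pullback_mono fun f g hf hg => (h f g hf hg).ge)

end Hausdorff

/-! ### Existence of parameters -/

section Parameters

theorem map_inclusion_lebesgueIco :
    lebesgueIco.map (Set.inclusion (Ico_subset_Icc_self : Ico (0 : ℝ) 1 ⊆ I)) = volume := by
  have hm : Measurable (Set.inclusion (Ico_subset_Icc_self : Ico (0 : ℝ) 1 ⊆ I)) :=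
    measurable_inclusion _
  ext s hs
  rw [Measure.map_apply hm hs, lebesgueIco,
    (MeasurableEmbedding.subtype_coe measurableSet_Ico).comap_apply,
    show (volume : Measure I) = Measure.comap Subtype.val volume from rfl,
    (MeasurableEmbedding.subtype_coe measurableSet_Icc).comap_apply]
  have h₁ : (Subtype.val '' (Set.inclusion (Ico_subset_Icc_self : Ico (0 : ℝ) 1 ⊆ I) ⁻¹' s)) =
      (Subtype.val '' s) ∩ Ico 0 1 := by
    ext x
    constructor
    · rintro ⟨y, hy, rfl⟩
      exact ⟨⟨_, hy, rfl⟩, y.2⟩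
    · rintro ⟨⟨y, hy, rfl⟩, hx⟩
      exact ⟨⟨y, hx⟩, hy, rfl⟩
  have h₂ : Subtype.val '' s ∩ Icc (0 : ℝ) 1 = Subtype.val '' s :=
    inter_eq_left.2 (by rintro _ ⟨y, -, rfl⟩; exact y.2)
  rw [h₁, ← h₂, inter_assoc, inter_eq_right.2 Ico_subset_Icc_self]
  -- `[0, 1)` and `[0, 1]` differ by a null set.
  exact measure_congr ((ae_eq_refl _).inter Ico_ae_eq_Icc)

instance isProbabilityMeasure_lebesgueIco : IsProbabilityMeasure lebesgueIco :=
  ⟨by rw [lebesgueIco, (MeasurableEmbedding.subtype_coe measurableSet_Ico).comap_apply,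
    image_univ, Subtype.range_coe, Real.volume_Ico]; simp⟩

theorem exists_isParameter {Z : Type*} [MeasurableSpace Z] [StandardBorelSpace Z] (m : Measure Z)
    [IsProbabilityMeasure m] : ∃ φ, IsParameter m φ := by
  have := m.nonempty_of_neZero
  obtain ⟨f, hf, hfm⟩ := m.exists_measurable_map_eq
  refine ⟨f ∘ Set.inclusion Ico_subset_Icc_self, hf.comp (measurable_inclusion _), ?_⟩
  rw [← Measure.map_map hf (measurable_inclusion _), map_inclusion_lebesgueIco, hfm]

end Parameters

/-! ### Limits of Lipschitz approximations -/

section Limits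

variable {ι Y : Type*} [PseudoMetricSpace Y]

/-- Equicontinuity reduces uniform closeness on `K` to closeness on a finite `δ / 3`-net. -/
theorem eventually_dist_le_of_tendsto_of_isCompact {l : Filter ι} {g : ι → Y → ℝ} {a : Y → ℝ}
    (hg : ∀ i, LipschitzWith 1 (g i)) (ha : LipschitzWith 1 a)
    (hlim : ∀ y, Tendsto (fun i => g i y) l (𝓝 (a y))) {K : Set Y} (hK : IsCompact K) {δ : ℝ}
    (hδ : 0 < δ) : ∀ᶠ i in l, ∀ y ∈ K, dist (g i y) (a y) ≤ δ := by
  obtain ⟨t, -, ht, hKt⟩ := hK.finite_cover_balls (show 0 < δ / 3 by positivity)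
  have h : ∀ᶠ i in l, ∀ c ∈ t, dist (g i c) (a c) < δ / 3 :=
    (eventually_all_finite ht).2 fun c _ => Metric.tendsto_nhds.1 (hlim c) _ (by positivity)
  filter_upwards [h] with i hi y hy
  obtain ⟨c, hc, hyc⟩ := mem_iUnion₂.1 (hKt hy)
  have h₁ := (hg i).dist_le_mul y c
  have h₂ := ha.dist_le_mul c y
  have h₃ := dist_triangle4 (g i y) (g i c) (a c) (a y)
  have h₄ := hi c hc
  rw [Metric.mem_ball] at hyc
  rw [dist_comm c y] at h₂
  simp only [NNReal.coe_one, one_mul] at h₁ h₂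
  linarith

/-- An ultrafilter gives all pointwise limits at once, in place of Arzelà–Ascoli with a diagonal
subsequence. -/
theorem exists_lipschitzWith_tendsto_ultrafilter (U : Ultrafilter ι) {g : ι → Y → ℝ}
    (hg : ∀ i, LipschitzWith 1 (g i)) (hb : ∀ y, ∃ C, ∀ᶠ i in U, |g i y| ≤ C) :
    ∃ a : Y → ℝ, LipschitzWith 1 a ∧ ∀ y, Tendsto (fun i => g i y) U (𝓝 (a y)) := by
  have h (y : Y) : ∃ a, Tendsto (fun i => g i y) U (𝓝 a) := by
    obtain ⟨C, hC⟩ := hb y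
    obtain ⟨a, -, ha⟩ := (isCompact_Icc (a := -C) (b := C)).ultrafilter_le_nhds'
      (U.map fun i => g i y) (Ultrafilter.mem_map.2 (hC.mono fun i hi => abs_le.1 hi))
    exact ⟨a, ha⟩
  choose a ha using h
  exact ⟨a, LipschitzWith.of_dist_le_mul fun x y => le_of_tendsto ((ha x).dist (ha y))
    (Eventually.of_forall fun i => (hg i).dist_le_mul x y), ha⟩

variable {Z : Type*} [MeasurableSpace Z]

/-- The set where `f` and `g` differ by more than `r` has mass at most `r`, and `r + (1 - r) / 2 <
1`, so it cannot cover `K`. This anchors the approximants and bounds them pointwise. -/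
theorem exists_mem_abs_sub_le_of_kyFanDist_lt {μ : Measure Z} [IsProbabilityMeasure μ]
    {f g : Z → ℝ} {r : ℝ≥0∞} (h : kyFanDist μ f g < r) (hr : r < 1) {K : Set Z}
    (hK : μ Kᶜ ≤ (1 - r) / 2) : ∃ z ∈ K, |f z - g z| ≤ 1 := by
  by_contra! hcon
  have hsub : K ⊆ {x | r < ENNReal.ofReal |f x - g x|} := fun z hz =>
    hr.trans (by simpa using hcon z hz)
  have h₁ : (1 : ℝ≥0∞) ≤ r + (1 - r) / 2 := by
    rw [← measure_univ (μ := μ), ← union_compl_self K]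
    exact (measure_union_le _ _).trans (add_le_add
      ((measure_mono hsub).trans (measure_lt_le_of_kyFanDist_lt h)) (by simpa using hK))
  have h₂ : (1 - r) / 2 < 1 - r := ENNReal.half_lt_self (tsub_pos_of_lt hr).ne'
    (ENNReal.sub_ne_top ENNReal.one_ne_top)
  have h₃ := ENNReal.add_lt_add_left (hr.ne_top) h₂
  rw [add_tsub_cancel_of_le hr.le] at h₃
  exact absurd h₁ (not_le.2 h₃)

/-- Approximability of `h` in the Ky Fan metric by `1`-Lipschitz functions of `q` passes to weak
limits of tight families of probability measures. -/
theorem exists_lipschitzWith_kyFanDist_le_of_tendsto [PseudoMetricSpace Z] [BorelSpace Z]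
    (U : Ultrafilter ι)
    {μ : ι → ProbabilityMeasure Z} {ν : ProbabilityMeasure Z} (hμ : Tendsto μ U (𝓝 ν))
    (ht : IsTightMeasureSet (range fun i => (μ i : Measure Z))) {h : Z → ℝ} (hh : Continuous h)
    {q : Z → Y} (hq : Continuous q) {r : ℝ≥0∞} (hr : r < 1)
    (hex : ∀ᶠ i in U, ∃ g : Y → ℝ, LipschitzWith 1 g ∧ kyFanDist (μ i : Measure Z) h (g ∘ q) < r) :
    ∃ g : Y → ℝ, LipschitzWith 1 g ∧ kyFanDist (ν : Measure Z) h (g ∘ q) ≤ r := by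
  rw [isTightMeasureSet_iff_exists_isCompact_measure_compl_le] at ht
  have hex' (i : ι) : ∃ g : Y → ℝ, LipschitzWith 1 g ∧
      ((∃ g : Y → ℝ, LipschitzWith 1 g ∧ kyFanDist (μ i : Measure Z) h (g ∘ q) < r) →
        kyFanDist (μ i : Measure Z) h (g ∘ q) < r) := by
    by_cases H : ∃ g : Y → ℝ, LipschitzWith 1 g ∧ kyFanDist (μ i : Measure Z) h (g ∘ q) < r
    · obtain ⟨g, hg, hgr⟩ := H
      exact ⟨g, hg, fun _ => hgr⟩
    -- A dummy value: such indices are negligible for `U`.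
    · exact ⟨fun _ => 0, LipschitzWith.const' 0, fun H' => absurd H' H⟩
  choose g hg hgr using hex'
  replace hgr : ∀ᶠ i in U, kyFanDist (μ i : Measure Z) h (g i ∘ q) < r :=
    hex.mono fun i hi => hgr i hi
  have hb (y : Y) : ∃ C, ∀ᶠ i in U, |g i y| ≤ C := by
    obtain ⟨K, hK, hKμ⟩ := ht ((1 - r) / 2) (ENNReal.half_pos (tsub_pos_of_lt hr).ne')
    obtain ⟨C₁, hC₁⟩ := hK.exists_bound_of_continuousOn hh.continuousOn
    obtain ⟨C₂, hC₂⟩ := hK.exists_bound_of_continuousOn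
      (f := fun z => dist y (q z)) (by fun_prop)
    refine ⟨C₁ + 1 + C₂, hgr.mono fun i hi => ?_⟩
    obtain ⟨z, hz, hzr⟩ := exists_mem_abs_sub_le_of_kyFanDist_lt hi hr (hKμ _ ⟨i, rfl⟩)
    have h₁ := hC₁ z hz
    have h₂ := hC₂ z hz
    have h₃ := (hg i).dist_le_mul y (q z)
    simp only [NNReal.coe_one, one_mul, Real.dist_eq, Real.norm_eq_abs, Function.comp_apply,
      abs_of_nonneg dist_nonneg] at h₁ h₂ h₃ hzr
    rw [abs_le] at *
    constructor <;> linarith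
  obtain ⟨a, ha, hlim⟩ := exists_lipschitzWith_tendsto_ultrafilter U hg hb
  -- The same `ε` serves twice: as the mass lost outside `K` and as the uniform error of `g i`
  -- against `a` on `q '' K`.
  refine ⟨a, ha, ENNReal.le_of_forall_pos_le_add fun ε hε _ => sInf_le ?_⟩
  obtain ⟨K, hK, hKμ⟩ := ht ε (by exact_mod_cast hε)
  have hG : IsOpen {z | r + ε < ENNReal.ofReal |h z - (a ∘ q) z|} :=
    isOpen_lt continuous_const (ENNReal.continuous_ofReal.comp
      (hh.sub (ha.continuous.comp hq)).abs)
  refine (ProbabilityMeasure.le_liminf_measure_open_of_tendsto hμ hG).trans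
    (liminf_le_of_frequently_le' (Eventually.frequently ?_))
  filter_upwards [hgr, eventually_dist_le_of_tendsto_of_isCompact hg ha hlim (hK.image hq)
    (show (0 : ℝ) < ε from hε)] with i hi hδ
  refine le_trans (measure_mono (t := {z | r < ENNReal.ofReal |h z - (g i ∘ q) z|} ∪ Kᶜ) ?_)
    ((measure_union_le _ _).trans
      (add_le_add (measure_lt_le_of_kyFanDist_lt hi) (hKμ _ ⟨i, rfl⟩)))
  intro z hz
  by_contra hcon
  simp only [mem_union, mem_ofPred_eq, mem_compl_iff, not_or, not_lt, not_not] at hcon hz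
  refine absurd hz (not_lt.2 ?_)
  calc ENNReal.ofReal |h z - (a ∘ q) z|
      ≤ ENNReal.ofReal (|h z - (g i ∘ q) z| + ε) := ENNReal.ofReal_le_ofReal
        ((abs_sub_le _ _ _).trans (add_le_add_right (hδ _ (mem_image_of_mem q hcon.2)) _))
    _ ≤ ENNReal.ofReal |h z - (g i ∘ q) z| + ENNReal.ofReal ε := ENNReal.ofReal_add_le
    _ ≤ r + ε := by
      rw [ENNReal.ofReal_coe_nnreal]
      exact add_le_add_left hcon.1 _

end Limits

/-! ### Compactness of plans and lower semicontinuity -/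

section Plans

variable {X Y : Type*} [MetricSpace X] [MeasurableSpace X] [MetricSpace Y] [MeasurableSpace Y]

theorem planObservableDist_le_one (π : Measure (X × Y)) [IsProbabilityMeasure π] :
    planObservableDist π ≤ 1 :=
  kyFanHausdorffDist_pullback_le
    (fun _ _ => ⟨fun _ => 0, LipschitzWith.const' 0, kyFanDist_le_one _ _ _⟩)
    (fun _ _ => ⟨fun _ => 0, LipschitzWith.const' 0, kyFanDist_le_one _ _ _⟩)

variable [BorelSpace X] [BorelSpace Y]

/-- Both marginals are fixed, and a single probability measure on a Polish space is tight. -/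
theorem isTightMeasureSet_transportPlans [CompleteSpace X] [SeparableSpace X]
    [CompleteSpace Y] [SeparableSpace Y] (mX : Measure X) [IsProbabilityMeasure mX]
    (mY : Measure Y) [IsProbabilityMeasure mY] : IsTightMeasureSet (transportPlans mX mY) := by
  have := UniformSpace.secondCountable_of_separable X
  have := UniformSpace.secondCountable_of_separable Y
  refine IsTightMeasureSet.prodMk ((isTightMeasureSet_singleton (μ := mX)).subset ?_)
    ((isTightMeasureSet_singleton (μ := mY)).subset ?_)
  · rintro _ ⟨π, hπ, rfl⟩
    exact hπ.2.1
  · rintro _ ⟨π, hπ, rfl⟩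
    exact hπ.2.2

theorem isCompact_setOf_mem_transportPlans [CompleteSpace X] [SeparableSpace X]
    [CompleteSpace Y] [SeparableSpace Y] (mX : Measure X) [IsProbabilityMeasure mX]
    (mY : Measure Y) [IsProbabilityMeasure mY] :
    IsCompact {π : ProbabilityMeasure (X × Y) | (π : Measure (X × Y)) ∈ transportPlans mX mY} := by
  have := UniformSpace.secondCountable_of_separable X
  have := UniformSpace.secondCountable_of_separable Y
  have hcl : IsClosed
      {π : ProbabilityMeasure (X × Y) | (π : Measure (X × Y)) ∈ transportPlans mX mY} := by
    have h : {π : ProbabilityMeasure (X × Y) | (π : Measure (X × Y)) ∈ transportPlans mX mY} =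
        {π | π.map continuous_fst.aemeasurable = ⟨mX, inferInstance⟩} ∩
        {π | π.map continuous_snd.aemeasurable = ⟨mY, inferInstance⟩} := by
      ext π
      exact ⟨fun h => ⟨Subtype.ext h.2.1, Subtype.ext h.2.2⟩,
        fun h => ⟨inferInstance, congrArg Subtype.val h.1, congrArg Subtype.val h.2⟩⟩
    rw [h]
    exact (isClosed_eq (ProbabilityMeasure.continuous_map continuous_fst)
      continuous_const).inter
      (isClosed_eq (ProbabilityMeasure.continuous_map continuous_snd) continuous_const)
  rw [← hcl.closure_eq]
  refine isCompact_closure_of_isTightMeasureSet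
    ((isTightMeasureSet_transportPlans mX mY).subset ?_)
  rintro _ ⟨π, hπ, rfl⟩
  exact hπ

theorem planObservableDist_le_of_tendsto [SecondCountableTopology X] [SecondCountableTopology Y]
    {ι : Type*} (U : Ultrafilter ι)
    {π : ι → ProbabilityMeasure (X × Y)} {ρ : ProbabilityMeasure (X × Y)}
    (hπ : Tendsto π U (𝓝 ρ)) (ht : IsTightMeasureSet (range fun i => (π i : Measure (X × Y))))
    {r : ℝ≥0∞} (h : ∀ᶠ i in U, planObservableDist (π i : Measure (X × Y)) < r) :
    planObservableDist (ρ : Measure (X × Y)) ≤ r := by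
  -- Only `r < 1` forces the approximants to stay bounded; otherwise the trivial bound `1` suffices.
  rcases le_or_gt 1 r with hr | hr
  · exact (planObservableDist_le_one _).trans hr
  refine kyFanHausdorffDist_pullback_le (fun f hf => ?_) (fun g hg => ?_)
  · exact exists_lipschitzWith_kyFanDist_le_of_tendsto U hπ ht (hf.continuous.comp continuous_fst)
      continuous_snd hr
      (h.mono fun i hi => exists_kyFanDist_lt_of_kyFanHausdorffDist_lt hi hf)
  · refine exists_lipschitzWith_kyFanDist_le_of_tendsto U hπ ht
      (hg.continuous.comp continuous_snd) continuous_fst hr (h.mono fun i hi => ?_)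
    rw [planObservableDist, kyFanHausdorffDist_comm] at hi
    exact exists_kyFanDist_lt_of_kyFanHausdorffDist_lt hi hg

theorem exists_planObservableDist_le [CompleteSpace X] [SeparableSpace X]
    [CompleteSpace Y] [SeparableSpace Y] (mX : Measure X) [IsProbabilityMeasure mX]
    (mY : Measure Y) [IsProbabilityMeasure mY] :
    ∃ π ∈ transportPlans mX mY, ∀ ρ ∈ transportPlans mX mY,
      planObservableDist π ≤ planObservableDist ρ := by
  have := UniformSpace.secondCountable_of_separable X
  have := UniformSpace.secondCountable_of_separable Y
  let S := planObservableDist '' transportPlans mX mY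
  have hne : S.Nonempty := ⟨_, mX.prod mY, ⟨inferInstance, by simp, by simp⟩, rfl⟩
  obtain ⟨u, -, hu, huS⟩ := exists_seq_tendsto_sInf hne (OrderBot.bddBelow S)
  choose π hπ hπu using huS
  let π' (n : ℕ) : ProbabilityMeasure (X × Y) := ⟨π n, (hπ n).1⟩
  obtain ⟨ρ, hρ, hlim⟩ := (isCompact_setOf_mem_transportPlans mX mY).ultrafilter_le_nhds'
    ((hyperfilter ℕ).map π') (Ultrafilter.mem_map.2 (univ_mem' hπ))
  refine ⟨ρ, hρ, fun τ hτ => le_trans ?_ (sInf_le (mem_image_of_mem _ hτ) : sInf S ≤ _)⟩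
  refine le_of_forall_gt_imp_ge_of_dense fun r hr =>
    planObservableDist_le_of_tendsto (hyperfilter ℕ) (π := π') hlim
      ((isTightMeasureSet_transportPlans mX mY).subset (range_subset_iff.2 hπ)) ?_
  filter_upwards [(hu.mono_left Nat.hyperfilter_le_atTop).eventually_lt_const hr] with n hn
  exact (hπu n).trans_lt hn

end Plans

theorem mainTheorem3 {X Y : Type*}
    [MetricSpace X] [CompleteSpace X] [SeparableSpace X] [MeasurableSpace X] [BorelSpace X]
    [MetricSpace Y] [CompleteSpace Y] [SeparableSpace Y] [MeasurableSpace Y] [BorelSpace Y]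
    (mX : Measure X) [IsProbabilityMeasure mX] (mY : Measure Y) [IsProbabilityMeasure mY] :
    IsLeast {d : ℝ≥0∞ | ∃ π ∈ transportPlans mX mY, d = planObservableDist π}
      (observableDist mX mY) := by
  have := UniformSpace.secondCountable_of_separable X
  have := UniformSpace.secondCountable_of_separable Y
  have hle : ∀ π ∈ transportPlans mX mY, observableDist mX mY ≤ planObservableDist π := by
    rintro π ⟨hπ, h₁, h₂⟩
    obtain ⟨θ, hθ, hθπ⟩ := exists_isParameter π
    have hφ : IsParameter mX (Prod.fst ∘ θ) :=
      ⟨measurable_fst.comp hθ, by rw [← Measure.map_map measurable_fst hθ, hθπ, h₁]⟩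
    have hψ : IsParameter mY (Prod.snd ∘ θ) :=
      ⟨measurable_snd.comp hθ, by rw [← Measure.map_map measurable_snd hθ, hθπ, h₂]⟩
    refine (iInf₂_le_of_le _ hφ (iInf₂_le _ hψ)).trans_eq ?_
    rw [← planObservableDist_map hφ.1 hψ.1]
    exact congrArg planObservableDist hθπ
  obtain ⟨π, hπ, hmin⟩ := exists_planObservableDist_le mX mY
  refine ⟨⟨π, hπ, le_antisymm (hle π hπ) ?_⟩, by rintro _ ⟨ρ, hρ, rfl⟩; exact hle ρ hρ⟩
  refine le_iInf₂ fun φ hφ => le_iInf₂ fun ψ hψ => ?_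
  rw [← planObservableDist_map hφ.1 hψ.1]
  have hm := hφ.1.prodMk hψ.1
  refine hmin _ ⟨Measure.isProbabilityMeasure_map hm.aemeasurable, ?_, ?_⟩
  · rw [Measure.map_map measurable_fst hm]
    exact hφ.2
  · rw [Measure.map_map measurable_snd hm]
    exact hψ.2
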